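/- Let $d\ge 3$, $t\ge 1$, and let $Q_1,\dots,Q_t$ be nondegenerate indefinite real quadratic forms in $d$ variables. Suppose that the hypersurfaces $\{Q_j=0\}\subset\mathbb{R}^d$, $j=1,\dots,t$, have a common tangent plane $H$ at a common point $\bar v\neq\bar 0$ (that is, $Q_j(\bar v)=0$ and the kernel of the differential of $Q_j$ at $\bar v$ is $H$ for every $j$). Let $\bar f_1,\dots,\bar f_d$ be any basis of $\mathbb{R}^d$ such that $\bar f_1$ is a direction vector of the line $\mathbb{R}\bar v$, $\bar f_2\notin H$, and $\bar f_i\in H$ for $i=3,\dots,d$, and define $a_s\in\mathrm{SL}(d,\mathbb{R})$, $s\in\mathbb{R}$, by $$a_s\bar f_1=e^{-s}\bar f_1,\qquad a_s\bar f_2=e^{s}\bar f_2,\qquad a_s\bar f_i=\bar f_i\quad(i=3,\dots,d).$$ Consider the property $$(\ast)\qquad \forall\varepsilon>0\ \ \exists \bar x\in\mathbb{Z}^d\setminus\{\bar 0\}:\ \max_{j=1,\dots,t}|Q_j(\bar x)|<\varepsilon .$$ If the semiorbit $\{a_s\,\mathrm{SL}(d,\mathbb{Z}) : s>0\}$ is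 not relatively compact in $\mathrm{SL}(d,\mathbb{R})/\mathrm{SL}(d,\mathbb{Z})$, then $(\ast)$ holds. Moreover, if for some $\alpha_1,\dots,\alpha_t\in\mathbb{R}$ the quadratic form $\sum_j\alpha_jQ_j$ is definite of rank $d-1$ (that is, it has rank $d-1$ and is either everywhere $\ge 0$ or everywhere $\le 0$), then $(\ast)$ implies that the semiorbit $\{a_s\,\mathrm{SL}(d,\mathbb{Z}) : s>0\}$ is not relatively compact in $\mathrm{SL}(d,\mathbb{R})/\mathrm{SL}(d,\mathbb{Z})$. -/

import Mathlib

open scoped MatrixGroups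

/-- A real quadratic form is indefinite if it takes both positive and negative values. -/
def IsIndefinite {d : ℕ} (Q : QuadraticForm ℝ (Fin d → ℝ)) : Prop :=
  (∃ x, 0 < Q x) ∧ ∃ x, Q x < 0

/-- The rank of a real quadratic form: the rank of its (polar) bilinear form. -/
noncomputable def quadRank {d : ℕ} (Q : QuadraticForm ℝ (Fin d → ℝ)) : ℕ :=
  Module.finrank ℝ (LinearMap.range Q.polarBilin)

/-- A real quadratic form is definite of rank `r` if it does not change sign and has rank `r`,
i.e. it induces a (positive or negative) definite form on the quotient by its radical, which has
dimension `r`. -/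
def IsDefiniteOfRank {d : ℕ} (Q : QuadraticForm ℝ (Fin d → ℝ)) (r : ℕ) : Prop :=
  ((∀ x, 0 ≤ Q x) ∨ (∀ x, Q x ≤ 0)) ∧ quadRank Q = r

/-- The tangent plane of the hypersurface `{Q = 0}` at a point `v` (as a linear subspace): the
kernel of the differential of `Q` at `v`. -/
noncomputable def tangentPlane {d : ℕ} (Q : QuadraticForm ℝ (Fin d → ℝ)) (v : Fin d → ℝ) :
    Submodule ℝ (Fin d → ℝ) :=
  LinearMap.ker (fderiv ℝ (fun x => Q x) v).toLinearMap

/-- The hypersurfaces `{Q j = 0}` all pass through the nonzero point `v`, and `H` is the tangent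
plane of each of them at `v`. -/
def HasCommonTangentPlane {d t : ℕ} (Q : Fin t → QuadraticForm ℝ (Fin d → ℝ))
    (v : Fin d → ℝ) (H : Submodule ℝ (Fin d → ℝ)) : Prop :=
  v ≠ 0 ∧ ∀ j, Q j v = 0 ∧ tangentPlane (Q j) v = H

/-- A basis `f` (indexed from `0`) is adapted to the line `ℝ v` and the plane `H` if its first
vector is a direction vector of the line, its second vector is outside of `H`, and all the further
ones are in `H`. -/
def IsAdaptedBasis {d : ℕ} (hd : 3 ≤ d) (f : Module.Basis (Fin d) ℝ (Fin d → ℝ))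
    (v : Fin d → ℝ) (H : Submodule ℝ (Fin d → ℝ)) : Prop :=
  f ⟨0, by omega⟩ ∈ Submodule.span ℝ {v} ∧ f ⟨1, by omega⟩ ∉ H ∧
    ∀ i : Fin d, 2 ≤ i.val → f i ∈ H

/-- The eigenvalues `e⁻ᵗ, eᵗ, 1, …, 1` of the diagonal flow. -/
noncomputable def flowWeight {d : ℕ} (s : ℝ) (i : Fin d) : ℝ :=
  if i.val = 0 then Real.exp (-s) else if i.val = 1 then Real.exp s else 1

theorem prod_flowWeight {d : ℕ} (hd : 3 ≤ d) (s : ℝ) : ∏ i : Fin d, flowWeight s i = 1 := by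
  obtain ⟨n, rfl⟩ : ∃ n, d = n + 2 := ⟨d - 2, by omega⟩
  rw [Fin.prod_univ_succ, Fin.prod_univ_succ]
  simp [flowWeight, ← Real.exp_add]

/-- The element `a_s` of `SL(d, ℝ)` which is diagonal in the basis `f`, with eigenvalues
`e⁻ˢ, eˢ, 1, …, 1` (as a matrix in the standard basis). -/
noncomputable def diagFlow {d : ℕ} (hd : 3 ≤ d) (f : Module.Basis (Fin d) ℝ (Fin d → ℝ))
    (s : ℝ) : SL(d, ℝ) :=
  ⟨LinearMap.toMatrix' (Matrix.toLin f f (Matrix.diagonal (flowWeight s))), by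
    rw [LinearMap.det_toMatrix', LinearMap.det_toLin, Matrix.det_diagonal, prod_flowWeight hd]⟩

theorem diagFlow_mulVec {d : ℕ} (hd : 3 ≤ d) (f : Module.Basis (Fin d) ℝ (Fin d → ℝ))
    (s : ℝ) (i : Fin d) :
    (diagFlow hd f s).1.mulVec (f i) = flowWeight s i • f i := by
  simp only [diagFlow, LinearMap.toMatrix'_mulVec, Matrix.toLin_self]
  simp [Matrix.diagonal_apply]

/-- `SL(d, ℤ)` as a subgroup of `SL(d, ℝ)`. -/
def integerSL (d : ℕ) : Subgroup SL(d, ℝ) :=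
  (Matrix.SpecialLinearGroup.map (n := Fin d) (Int.castRingHom ℝ)).range

/-- The semiorbit `{a_s SL(d, ℤ) : s > 0}` in `SL(d, ℝ) / SL(d, ℤ)`. -/
def semiorbit {d : ℕ} (hd : 3 ≤ d) (f : Module.Basis (Fin d) ℝ (Fin d → ℝ)) :
    Set (SL(d, ℝ) ⧸ integerSL d) :=
  {x | ∃ s : ℝ, 0 < s ∧ x = QuotientGroup.mk (diagFlow hd f s)}

/-- A subset of a topological space is relatively compact if its closure is compact. -/
def IsRelativelyCompact {X : Type*} [TopologicalSpace X] (S : Set X) : Prop :=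
  IsCompact (closure S)

/-- For every `ε > 0` there is a nonzero integer vector `x` with `max_j |Q_j(x)| < ε`. -/
def HasSmallIntegerValues {d t : ℕ} (Q : Fin t → QuadraticForm ℝ (Fin d → ℝ)) : Prop :=
  ∀ ε : ℝ, 0 < ε → ∃ x : Fin d → ℤ, x ≠ 0 ∧ ∀ j, |Q j (fun i => (x i : ℝ))| < ε

/-!
In an adapted basis, with coordinates `c₀, c₁, …` of `x`, the vector `f₀` spans the isotropic line
`ℝ v`, and all the `fᵢ` with `i ≥ 2` are orthogonal to it. Hence
`Q j x = β j * c₀ * c₁ + (a form in c₁, c₂, …)` with `β j ≠ 0`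
(`IsAdaptedBasis.apply_eq`, `IsAdaptedBasis.polar_ne_zero`). The flow `a_s` preserves the product
`c₀ * c₁`, and for `s > 0` it does not contract any of `c₁, c₂, …`.

By Mahler's compactness criterion (`isRelativelyCompact_image_mk_iff`) the semiorbit fails to be
relatively compact exactly if the lattices `a_s ℤᵈ`, `s > 0`, contain arbitrarily short nonzero
vectors. If `a_s x` is short, then `c₀ * c₁` and all of `c₁, c₂, …` are small, and so are all the
`Q j x`. Conversely, a definite combination `P` of rank `d - 1` has radical `ℝ v`, so it is
comparable to `c₁² + c₂² + ⋯` (`IsDefiniteOfRank.exists_mul_sq_le_abs`). If all the `Q j x` are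
small, then `P x` is small, hence so are `c₁, c₂, …`, and finally `c₀ * c₁`. As `x` is a nonzero
integer vector, `c₀` is then bounded away from zero, and `a_s` contracts it to a prescribed small
size `ρ` at some time `s > 0`, at which `c₁` has only grown to size `|c₀ * c₁| / ρ`.

The hard half of Mahler's criterion asks for a bounded basis of any unimodular lattice `g ℤᵈ`
without short vectors. Minkowski's theorem, applied to a box that is thin along a hyperplane and
long across it, shows that the lattice vectors of bounded length lie on no hyperplane. Thus
there is an integer matrix `A` with `det A ≠ 0` and `g * A` bounded, so that `det A` is bounded as
well. Up to left multiplication by `SL(d, ℤ)` there are finitely many such `A`, so that `A = γ * B`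
with `B` from a finite set, and `g * γ = (g * A) * B⁻¹` is bounded.
-/

/-! ### Short independent lattice vectors -/

/-- **Minkowski's theorem on linear forms**: a system of linear forms with nonzero determinant of
absolute value less than `1` is bounded by `1` at some nonzero integer vector. -/
theorem Matrix.exists_int_ne_zero_abs_mulVec_le_one {ι : Type*} [Fintype ι] [DecidableEq ι]
    (h : Matrix ι ι ℝ) (h0 : h.det ≠ 0) (h1 : |h.det| < 1) :
    ∃ x : ι → ℤ, x ≠ 0 ∧ ∀ i, |h.mulVec (fun i => (x i : ℝ)) i| ≤ 1 := by
  let L := (Submodule.span ℤ (Set.range (Pi.basisFun ℝ ι))).toAddSubgroup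
  let K : Set (ι → ℝ) := (Matrix.toLin' h) ⁻¹' Metric.closedBall 0 1
  have hdet : LinearMap.det (Matrix.toLin' h) ≠ 0 := by rwa [LinearMap.det_toLin']
  have fund := ZSpan.isAddFundamentalDomain' (Pi.basisFun ℝ ι) MeasureTheory.volume
  have hvol : MeasureTheory.volume (ZSpan.fundamentalDomain (Pi.basisFun ℝ ι)) *
      2 ^ Module.finrank ℝ (ι → ℝ) < MeasureTheory.volume K := by
    rw [ZSpan.fundamentalDomain_pi_basisFun, MeasureTheory.volume_pi,
      MeasureTheory.Measure.pi_pi, ← MeasureTheory.volume_pi,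
      MeasureTheory.Measure.addHaar_preimage_linearMap _ hdet, Real.volume_pi_closedBall _ (by simp),
      LinearMap.det_toLin', Module.finrank_fintype_fun_eq_card]
    simp only [Real.volume_Ico, sub_zero, ENNReal.ofReal_one, Finset.prod_const_one, one_mul,
      mul_one]
    rw [show (2 : ENNReal) = ENNReal.ofReal 2 by simp, ← ENNReal.ofReal_pow (by simp),
      ← ENNReal.ofReal_mul (abs_nonneg _), ENNReal.ofReal_lt_ofReal_iff_of_nonneg (by positivity),
      abs_inv]
    exact lt_mul_left (by positivity) ((one_lt_inv₀ (abs_pos.2 h0)).2 h1)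
  have hK : Convex ℝ K := (convex_closedBall (0 : ι → ℝ) 1).linear_preimage _
  have : Countable L :=
    inferInstanceAs (Countable (Submodule.span ℤ (Set.range (Pi.basisFun ℝ ι))))
  obtain ⟨⟨x, hxL⟩, hx0, hxK⟩ :=
    MeasureTheory.exists_ne_zero_mem_lattice_of_measure_mul_two_pow_lt_measure fund
      (s := K) (fun x hx => by simpa [K, Matrix.mulVec_neg] using hx) hK hvol
  rw [Submodule.mem_toAddSubgroup, Module.Basis.mem_span_iff_repr_mem] at hxL
  choose z hz using hxL
  have hz' : (fun i => (z i : ℝ)) = x := by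
    ext i
    simpa using hz i
  refine ⟨z, ?_, fun i => ?_⟩
  · rintro rfl
    apply hx0
    ext i
    simp [← hz']
  · rw [hz', ← Real.norm_eq_abs]
    have : ‖Matrix.toLin' h x‖ ≤ 1 := by simpa [K] using hxK
    exact (norm_le_pi_norm _ i).trans (by simpa using this)

/-- A unimodular lattice without short nonzero vectors has a nonzero vector of controlled length
off any given hyperplane `w ⬝ᵥ y = 0`. -/
theorem Matrix.exists_int_dotProduct_mulVec_ne_zero {ι : Type*} [Fintype ι] [DecidableEq ι]
    {ε : ℝ} (hε : 0 < ε) : ∃ R : ℝ, 0 < R ∧ ∀ g : Matrix ι ι ℝ, g.det = 1 →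
      (∀ x : ι → ℤ, x ≠ 0 → ∃ i, ε ≤ |g.mulVec (fun i => (x i : ℝ)) i|) →
      ∀ w : ι → ℝ, w ≠ 0 → ∃ x : ι → ℤ, (∀ i, |g.mulVec (fun i => (x i : ℝ)) i| ≤ R) ∧
        w ⬝ᵥ g.mulVec (fun i => (x i : ℝ)) ≠ 0 := by
  set n := Fintype.card ι with hn
  -- Off the coordinate `k` where `w` is largest, lattice points are confined to `[-δ, δ]`; the
  -- `k`-th coordinate is replaced by the form `w`, confined to the long interval `[-M, M]`.
  let δ : ℝ := ε / (2 * (n + 1))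
  have hδ : 0 < δ := by positivity
  let M : ℝ := 2 * (δ⁻¹ ^ n + 1) * (δ + 1)
  have hM : 0 < M := by positivity
  refine ⟨M + n * δ + δ, by positivity, fun g hg hgε w hw => ?_⟩
  obtain ⟨i₀, hi₀⟩ : ∃ i, w i ≠ 0 := by
    by_contra! h
    exact hw (funext h)
  have : Nonempty ι := ⟨i₀⟩
  obtain ⟨k, hk⟩ := Finite.exists_max fun i => |w i|
  have hwk : 0 < |w k| := (abs_pos.2 hi₀).trans_le (hk i₀)
  let u : ι → ℝ := (w k)⁻¹ • w
  have huk : u k = 1 := by simp [u, abs_pos.1 hwk]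
  have hu : ∀ i, |u i| ≤ 1 := fun i => by
    simp only [u, Pi.smul_apply, smul_eq_mul, abs_mul, abs_inv]
    rw [inv_mul_le_iff₀ hwk, mul_one]
    exact hk i
  have hwu : ∀ y, u ⬝ᵥ y = (w k)⁻¹ * (w ⬝ᵥ y) := fun y => by simp [u, smul_dotProduct]
  let D : ι → ℝ := Function.update (fun _ => δ⁻¹) k M⁻¹
  let h : Matrix ι ι ℝ := Matrix.diagonal D * (Matrix.updateRow 1 k u * g)
  have hDdet : ∏ i, D i = M⁻¹ * δ⁻¹ ^ (n - 1) := by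
    rw [Finset.prod_update_of_mem (Finset.mem_univ k), Finset.prod_const, hn,
      Finset.card_sdiff_of_subset (by simp)]
    simp
  have hudet : (Matrix.updateRow (1 : Matrix ι ι ℝ) k u).det = 1 := by
    have := Matrix.det_updateRow_sum (1 : Matrix ι ι ℝ) k u
    rw [Matrix.det_one, huk, smul_eq_mul, mul_one] at this
    rw [← this]
    congr 2
    ext j
    simp [Matrix.one_apply]
  have hdet : h.det = M⁻¹ * δ⁻¹ ^ (n - 1) := by
    rw [Matrix.det_mul, Matrix.det_mul, hudet, hg, Matrix.det_diagonal, hDdet]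
    ring
  have hpow : δ⁻¹ ^ (n - 1) < M := by
    have h1 : δ⁻¹ ^ (n - 1) = δ⁻¹ ^ n * δ := by
      have : n = (n - 1) + 1 := (Nat.succ_pred_eq_of_pos Fintype.card_pos).symm
      conv_rhs => rw [this, pow_succ, mul_assoc, inv_mul_cancel₀ hδ.ne', mul_one]
    rw [h1]
    have : 0 < δ⁻¹ ^ n := by positivity
    simp only [M]
    nlinarith [mul_pos this hδ]
  have hpos : 0 < M⁻¹ * δ⁻¹ ^ (n - 1) := by positivity
  obtain ⟨x, hx0, hx⟩ := h.exists_int_ne_zero_abs_mulVec_le_one (by rw [hdet]; exact hpos.ne')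
    (by rw [hdet, abs_of_pos hpos, inv_mul_lt_iff₀ hM, mul_one]; exact hpow)
  set y := g.mulVec (fun i => (x i : ℝ)) with hy
  have hhx : ∀ i, h.mulVec (fun i => (x i : ℝ)) i = D i * Function.update y k (u ⬝ᵥ y) i := by
    intro i
    simp only [h]
    rw [← Matrix.mulVec_mulVec, ← Matrix.mulVec_mulVec, Matrix.mulVec_diagonal,
      Matrix.updateRow_mulVec, Matrix.one_mulVec]
  have hne : ∀ i, i ≠ k → |y i| ≤ δ := fun i hi => by
    have := hx i
    rw [hhx] at this
    simpa [D, hi, abs_mul, abs_of_pos hδ, inv_mul_le_iff₀ hδ] using this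
  have hform : |u ⬝ᵥ y| ≤ M := by
    have := hx k
    rw [hhx] at this
    simpa [D, abs_mul, abs_of_pos hM, inv_mul_le_iff₀ hM] using this
  have hyk : |y k| ≤ |u ⬝ᵥ y| + n * δ := by
    have h1 : u ⬝ᵥ y = y k + ∑ i ∈ Finset.univ.erase k, u i * y i := by
      rw [dotProduct, ← Finset.add_sum_erase _ _ (Finset.mem_univ k), huk, one_mul]
    have h2 : |∑ i ∈ Finset.univ.erase k, u i * y i| ≤ n * δ := by
      refine (Finset.abs_sum_le_sum_abs _ _).trans ?_
      refine (Finset.sum_le_card_nsmul _ _ δ fun i hi => ?_).trans ?_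
      · rw [abs_mul]
        exact (mul_le_of_le_one_left (abs_nonneg _) (hu i)).trans (hne i (Finset.ne_of_mem_erase hi))
      · rw [nsmul_eq_mul]
        gcongr
        exact Finset.card_erase_le
    rw [h1]
    have := abs_sub (y k + ∑ i ∈ Finset.univ.erase k, u i * y i)
      (∑ i ∈ Finset.univ.erase k, u i * y i)
    rw [add_sub_cancel_right] at this
    linarith
  refine ⟨x, fun i => ?_, fun h0 => ?_⟩
  · by_cases hi : i = k
    · subst hi; linarith
    · have := hne i hi
      have : 0 ≤ n * δ := by positivity
      linarith
  · -- A lattice point on the hyperplane would be too short.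
    rw [hwu, h0, mul_zero, abs_zero, zero_add] at hyk
    obtain ⟨i, hi⟩ := hgε x hx0
    have hle : |y i| ≤ (n + 1) * δ := by
      by_cases hik : i = k
      · subst hik; linarith
      · have := hne i hik
        have : 0 ≤ n * δ := by positivity
        linarith
    have : (n + 1) * δ = ε / 2 := by simp only [δ]; field_simp
    linarith

/-- A unimodular lattice without short nonzero vectors contains a full set of linearly independent
vectors of bounded length (the columns of `g * A`). -/
theorem Matrix.exists_int_det_ne_zero_abs_mul_le {ι : Type*} [Fintype ι] [DecidableEq ι]
    {ε : ℝ} (hε : 0 < ε) : ∃ R : ℝ, 0 < R ∧ ∀ g : Matrix ι ι ℝ, g.det = 1 →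
      (∀ x : ι → ℤ, x ≠ 0 → ∃ i, ε ≤ |g.mulVec (fun i => (x i : ℝ)) i|) →
      ∃ A : Matrix ι ι ℤ, A.det ≠ 0 ∧ ∀ i j, |(g * A.map (Int.castRingHom ℝ)) i j| ≤ R := by
  obtain ⟨R, hR, h⟩ := Matrix.exists_int_dotProduct_mulVec_ne_zero (ι := ι) hε
  refine ⟨R, hR, fun g hg hgε => ?_⟩
  let S : Set (ι → ℝ) := {y | ∃ x : ι → ℤ, g.mulVec (fun i => (x i : ℝ)) = y ∧ ∀ i, |y i| ≤ R}
  have hS : Submodule.span ℝ S = ⊤ := by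
    by_contra hne
    obtain ⟨φ, hφ0, hφ⟩ := Submodule.exists_le_ker_of_lt_top _ (lt_top_iff_ne_top.2 hne)
    have hφw : ∀ y, φ y = (fun i => φ (Pi.single i 1)) ⬝ᵥ y := fun y => by
      conv_lhs => rw [pi_eq_sum_univ' y, map_sum]
      refine Finset.sum_congr rfl fun i _ => ?_
      rw [map_smul, smul_eq_mul, mul_comm]
    obtain ⟨x, hxR, hx⟩ := h g hg hgε (fun i => φ (Pi.single i 1)) fun hw => hφ0 <| by
      ext y
      simpa using congrFun hw y
    rw [← hφw] at hx
    exact hx (hφ (Submodule.subset_span ⟨x, rfl, hxR⟩))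
  obtain ⟨b, hbS, hbspan, hblin⟩ := exists_linearIndependent ℝ S
  let B : Module.Basis b ℝ (ι → ℝ) := Module.Basis.mk hblin (by simp [hbspan, hS])
  let e : b ≃ ι := B.indexEquiv (Pi.basisFun ℝ ι)
  have hb : ∀ j, ∃ x : ι → ℤ, g.mulVec (fun i => (x i : ℝ)) = ((e.symm j : b) : ι → ℝ) ∧
      ∀ i, |((e.symm j : b) : ι → ℝ) i| ≤ R := fun j => hbS (e.symm j).2
  choose x hx hxR using hb
  let A : Matrix ι ι ℤ := Matrix.of fun i j => x j i
  have hgA : ∀ i j, (g * A.map (Int.castRingHom ℝ)) i j = ((e.symm j : b) : ι → ℝ) i := fun i j => by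
    rw [← hx j]
    simp [Matrix.mul_apply, Matrix.mulVec, dotProduct, A]
  refine ⟨A, fun hA => ?_, fun i j => by rw [hgA]; exact hxR j i⟩
  have hunit : IsUnit (g * A.map (Int.castRingHom ℝ)) := by
    rw [← Matrix.linearIndependent_cols_iff_isUnit]
    have : (g * A.map (Int.castRingHom ℝ)).col = fun j => ((e.symm j : b) : ι → ℝ) := by
      ext j i
      exact hgA i j
    rw [this]
    exact hblin.comp _ e.symm.injective
  rw [Matrix.isUnit_iff_isUnit_det, Matrix.det_mul] at hunit
  apply hunit.ne_zero
  rw [← RingHom.mapMatrix_apply, ← RingHom.map_det, hA, map_zero, mul_zero]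

/-! ### Mahler's compactness criterion -/

/-- Up to left multiplication by `SL(ι, ℤ)` there are only finitely many integer matrices of bounded
nonzero determinant: two matrices of determinant `n` which agree modulo `n` are equivalent. -/
theorem Matrix.exists_finite_forall_eq_specialLinearGroup_mul (ι : Type*) [Fintype ι]
    [DecidableEq ι] (N : ℤ) : ∃ T : Set (Matrix ι ι ℤ), T.Finite ∧ (∀ B ∈ T, B.det ≠ 0) ∧
      ∀ A : Matrix ι ι ℤ, A.det ≠ 0 → |A.det| ≤ N →
        ∃ B ∈ T, ∃ γ : Matrix.SpecialLinearGroup ι ℤ, A = γ.1 * B := by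
  let S : Set (Matrix ι ι ℤ) := {A | A.det ≠ 0 ∧ |A.det| ≤ N}
  let key : Matrix ι ι ℤ → ℤ × (ι → ι → ℤ) := fun A => (A.det, fun i j => A i j % A.det)
  have hfin : (key '' S).Finite := by
    refine Set.Finite.subset ((Set.finite_Icc (-N) N).prod (Set.Finite.pi' fun _ : ι =>
      Set.Finite.pi' fun _ : ι => Set.finite_Icc 0 N)) ?_
    rintro _ ⟨A, ⟨hA0, hAN⟩, rfl⟩
    exact ⟨abs_le.1 hAN, fun i j => ⟨Int.emod_nonneg _ hA0,
      (Int.emod_lt_abs _ hA0).le.trans hAN⟩⟩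
  obtain ⟨T, hTS, hT⟩ := Set.exists_subset_bijOn S key
  refine ⟨T, Set.Finite.of_finite_image (hT.image_eq ▸ hfin) hT.injOn, fun B hB => (hTS hB).1,
    fun A hA0 hAN => ?_⟩
  obtain ⟨B, hBT, hB⟩ := hT.surjOn ⟨A, ⟨hA0, hAN⟩, rfl⟩
  have hdet : B.det = A.det := congrArg Prod.fst hB
  have hmod : ∀ i j, ∃ c, A i j - B i j = A.det * c := fun i j => by
    have := congrFun₂ (congrArg Prod.snd hB) i j
    simp only [key, hdet] at this
    exact Int.ModEq.dvd this
  choose X hX using hmod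
  have hmul : (1 + Matrix.of X * B.adjugate) * B = A := by
    rw [add_mul, one_mul, mul_assoc, Matrix.adjugate_mul, hdet]
    ext i j
    rw [Matrix.mul_smul, mul_one, Matrix.add_apply, Matrix.smul_apply, Matrix.of_apply,
      smul_eq_mul, ← hX i j, add_sub_cancel]
  refine ⟨B, hBT, ⟨1 + Matrix.of X * B.adjugate, ?_⟩, hmul.symm⟩
  have := congrArg Matrix.det hmul
  rw [Matrix.det_mul, hdet] at this
  exact mul_right_cancel₀ hA0 (this.trans (one_mul _).symm)

/-- The reduction theory behind Mahler's criterion: a unimodular lattice without short nonzero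
vectors has a bounded basis, with a bound depending only on the length of the shortest vector. -/
theorem Matrix.SpecialLinearGroup.exists_abs_mul_map_int_le {ι : Type*} [Fintype ι] [DecidableEq ι]
    {ε : ℝ} (hε : 0 < ε) : ∃ C : ℝ, ∀ g : Matrix.SpecialLinearGroup ι ℝ,
      (∀ x : ι → ℤ, x ≠ 0 → ∃ i, ε ≤ |g.1.mulVec (fun i => (x i : ℝ)) i|) →
      ∃ γ : Matrix.SpecialLinearGroup ι ℤ, ∀ i j,
        |(g * Matrix.SpecialLinearGroup.map (Int.castRingHom ℝ) γ).1 i j| ≤ C := by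
  obtain ⟨R, hR, h⟩ := Matrix.exists_int_det_ne_zero_abs_mul_le (ι := ι) hε
  obtain ⟨T, hTfin, hT0, hT⟩ := Matrix.exists_finite_forall_eq_specialLinearGroup_mul ι
    ⌊(Fintype.card ι).factorial • R ^ Fintype.card ι⌋
  obtain ⟨E, hE⟩ : ∃ E : ℝ, ∀ B ∈ T, ∀ i j, |(B.adjugate i j : ℝ)| ≤ E := by
    have : ((fun B : Matrix ι ι ℤ => ∑ i, ∑ j, |(B.adjugate i j : ℝ)|) '' T).Finite :=
      hTfin.image _
    obtain ⟨E, hE⟩ := this.bddAbove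
    refine ⟨E, fun B hB i j => le_trans ?_ (hE ⟨B, hB, rfl⟩)⟩
    exact (Finset.single_le_sum (f := fun j => |(B.adjugate i j : ℝ)|)
      (fun _ _ => abs_nonneg _) (Finset.mem_univ j)).trans
      (Finset.single_le_sum (f := fun i => ∑ j, |(B.adjugate i j : ℝ)|)
        (fun _ _ => Finset.sum_nonneg fun _ _ => abs_nonneg _) (Finset.mem_univ i))
  refine ⟨Fintype.card ι * (R * E), fun g hg => ?_⟩
  obtain ⟨A, hA0, hAR⟩ := h g.1 g.2 hg
  have hcast : ((A.det : ℤ) : ℝ) = (g.1 * A.map (Int.castRingHom ℝ)).det := by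
    rw [Matrix.det_mul, g.2, one_mul, ← RingHom.mapMatrix_apply, ← RingHom.map_det]
    simp
  obtain ⟨B, hBT, γ, hγ⟩ := hT A hA0 (Int.le_floor.2 <| by
    rw [Int.cast_abs, hcast]
    exact Matrix.det_le (abv := AbsoluteValue.abs) hAR)
  refine ⟨γ, fun i j => ?_⟩
  -- `B⁻¹` is replaced by the adjugate, at the cost of the factor `det B`, an integer.
  have key : (B.det : ℝ) • (g * Matrix.SpecialLinearGroup.map (Int.castRingHom ℝ) γ).1 =
      (g.1 * A.map (Int.castRingHom ℝ)) * B.adjugate.map (Int.castRingHom ℝ) := by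
    have h1 : (B.map (Int.castRingHom ℝ)) * B.adjugate.map (Int.castRingHom ℝ) =
        (B.det : ℝ) • (1 : Matrix ι ι ℝ) := by
      rw [← Matrix.map_mul, Matrix.mul_adjugate]
      ext i j
      simp only [Matrix.map_apply, Matrix.smul_apply, Matrix.one_apply]
      split_ifs <;> simp
    rw [hγ, Matrix.map_mul, mul_assoc, mul_assoc, h1]
    rw [Matrix.mul_smul, Matrix.mul_smul, mul_one]
    rfl
  have hdet : (1 : ℝ) ≤ |(B.det : ℝ)| := by
    exact_mod_cast Int.one_le_abs (hT0 B hBT)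
  have h2 := congrFun₂ key i j
  rw [Matrix.smul_apply, smul_eq_mul] at h2
  calc _ ≤ |(B.det : ℝ)| *
        |(g * Matrix.SpecialLinearGroup.map (Int.castRingHom ℝ) γ).1 i j| :=
        le_mul_of_one_le_left (abs_nonneg _) hdet
    _ = |∑ k, (g.1 * A.map (Int.castRingHom ℝ)) i k * (B.adjugate k j : ℝ)| := by
        rw [← abs_mul, h2, Matrix.mul_apply]
        rfl
    _ ≤ ∑ k : ι, R * E := by
        refine (Finset.abs_sum_le_sum_abs _ _).trans (Finset.sum_le_sum fun k _ => ?_)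
        rw [abs_mul]
        exact mul_le_mul (hAR i k) (hE B hBT k j) (abs_nonneg _) hR.le
    _ = _ := by simp

theorem isClosed_integerSL (d : ℕ) : IsClosed (integerSL d : Set SL(d, ℝ)) := by
  have h : Topology.IsClosedEmbedding (Int.castRingHom ℝ) := Int.isClosedEmbedding_coe_real
  exact h.specialLinearGroup_map.isClosed_range

theorem Matrix.SpecialLinearGroup.isCompact_setOf_abs_le {ι : Type*} [Fintype ι] [DecidableEq ι]
    (C : ℝ) : IsCompact {g : Matrix.SpecialLinearGroup ι ℝ | ∀ i j, |g.1 i j| ≤ C} := by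
  have h := Matrix.SpecialLinearGroup.isClosedEmbedding_val (n := ι) (R := ℝ) |>.isCompact_preimage
    (IsCompact.matrix (m := ι) (n := ι) (isCompact_Icc (a := -C) (b := C)))
  have heq : {g : Matrix.SpecialLinearGroup ι ℝ | ∀ i j, |g.1 i j| ≤ C} =
      Subtype.val ⁻¹' (Set.Icc (-C) C).matrix := by
    ext g
    simp only [abs_le]
    rfl
  rw [heq]
  exact h

/-- **Mahler's compactness criterion**: a set of unimodular lattices is relatively compact if and
only if the lengths of their nonzero vectors are bounded away from zero. -/
theorem isRelativelyCompact_image_mk_iff {d : ℕ} (S : Set SL(d, ℝ)) :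
    IsRelativelyCompact ((QuotientGroup.mk : SL(d, ℝ) → SL(d, ℝ) ⧸ integerSL d) '' S) ↔
      ∃ ε : ℝ, 0 < ε ∧ ∀ g ∈ S, ∀ x : Fin d → ℤ, x ≠ 0 →
        ∃ i, ε ≤ |g.1.mulVec (fun i => (x i : ℝ)) i| := by
  constructor
  · intro hS
    -- The images of the sets where `g⁻¹` has entries less than `n` are an open exhaustion, so
    -- compactness gives representatives `u` of all the cosets with uniformly bounded `u⁻¹`.
    let V : ℕ → Set SL(d, ℝ) := fun n => {g | ∀ i j, |g⁻¹.1 i j| < n}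
    have hVopen : ∀ n, IsOpen (V n) := fun n => by
      simp only [V, Set.ofPred_forall]
      refine isOpen_iInter_of_finite fun i => isOpen_iInter_of_finite fun j => ?_
      have : Continuous fun g : SL(d, ℝ) => g⁻¹.1 i j :=
        (continuous_subtype_val.comp (continuous_inv (G := SL(d, ℝ)))).matrix_elem i j
      exact isOpen_lt this.abs continuous_const
    have hVmono : ∀ m n, m ≤ n → V m ⊆ V n := fun m n hmn g hg i j =>
      (hg i j).trans_le (by exact_mod_cast hmn)
    obtain ⟨n, hn⟩ := IsCompact.elim_directed_cover (s := closure _) hS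
      (fun n => (QuotientGroup.mk : SL(d, ℝ) → SL(d, ℝ) ⧸ integerSL d) '' V n)
      (fun n => QuotientGroup.isOpenMap_coe _ (hVopen n))
      (fun q _ => by
        obtain ⟨g, rfl⟩ := QuotientGroup.mk_surjective q
        obtain ⟨n, hn⟩ := exists_nat_gt (∑ i, ∑ j, |g⁻¹.1 i j|)
        refine Set.mem_iUnion.2 ⟨n, g, fun i j => lt_of_le_of_lt ?_ hn, rfl⟩
        exact (Finset.single_le_sum (f := fun j => |g⁻¹.1 i j|)
          (fun _ _ => abs_nonneg _) (Finset.mem_univ j)).trans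
          (Finset.single_le_sum (f := fun i => ∑ j, |g⁻¹.1 i j|)
            (fun _ _ => Finset.sum_nonneg fun _ _ => abs_nonneg _) (Finset.mem_univ i)))
      (directed_of_isDirected_le fun m n hmn => Set.image_mono (hVmono m n hmn))
    refine ⟨1 / (n * d + 1), by positivity, fun g hg x hx => ?_⟩
    obtain ⟨u, hu, hug⟩ := hn (subset_closure ⟨g, hg, rfl⟩)
    rw [QuotientGroup.eq] at hug
    obtain ⟨γ, hγ⟩ := hug
    let z : Fin d → ℤ := γ.1.mulVec x
    have hz : (fun i => (z i : ℝ)) = u⁻¹.1.mulVec (g.1.mulVec fun i => (x i : ℝ)) := by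
      rw [Matrix.mulVec_mulVec, ← Matrix.SpecialLinearGroup.coe_mul, ← hγ]
      ext i
      simp [z, Matrix.mulVec, dotProduct]
    have hz0 : z ≠ 0 := fun h => hx <| by
      have : γ⁻¹.1.mulVec z = x := by
        simp only [z]
        rw [Matrix.mulVec_mulVec, ← Matrix.SpecialLinearGroup.coe_mul, inv_mul_cancel,
          Matrix.SpecialLinearGroup.coe_one, Matrix.one_mulVec]
      rw [← this, h, Matrix.mulVec_zero]
    obtain ⟨i, hi⟩ : ∃ i, z i ≠ 0 := by
      by_contra! h
      exact hz0 (funext h)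
    by_contra! hlt
    have h1 : (1 : ℝ) ≤ |(z i : ℝ)| := by exact_mod_cast Int.one_le_abs hi
    have h2 : |(z i : ℝ)| ≤ ∑ _j : Fin d, (n : ℝ) * (1 / (n * d + 1)) := by
      rw [congrFun hz i, Matrix.mulVec, dotProduct]
      refine (Finset.abs_sum_le_sum_abs _ _).trans (Finset.sum_le_sum fun j _ => ?_)
      rw [abs_mul]
      exact mul_le_mul (hu i j).le (hlt j).le (abs_nonneg _) (Nat.cast_nonneg n)
    have h3 : ∑ _j : Fin d, (n : ℝ) * (1 / (n * d + 1)) < 1 := by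
      rw [Finset.sum_const, Finset.card_univ, Fintype.card_fin, nsmul_eq_mul, ← mul_assoc,
        mul_one_div, div_lt_one (by positivity)]
      linarith
    linarith
  · rintro ⟨ε, hε, h⟩
    obtain ⟨C, hC⟩ := Matrix.SpecialLinearGroup.exists_abs_mul_map_int_le (ι := Fin d) hε
    have := isClosed_integerSL d
    refine ((Matrix.SpecialLinearGroup.isCompact_setOf_abs_le C).image
      (QuotientGroup.continuous_mk (N := integerSL d))).closure_of_subset ?_
    rintro _ ⟨g, hg, rfl⟩
    obtain ⟨γ, hγ⟩ := hC g (h g hg)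
    refine ⟨_, hγ, ?_⟩
    rw [QuotientGroup.mk_mul_of_mem]
    exact ⟨γ, rfl⟩

/-! ### Quadratic forms in an adapted basis -/

theorem QuadraticMap.differentiable {d : ℕ} (Q : QuadraticForm ℝ (Fin d → ℝ)) :
    Differentiable ℝ (fun x => Q x) := by
  have h : (fun x => Q x) = fun x => (2 : ℝ)⁻¹ * Q.polarBilin.toContinuousBilinearMap x x := by
    ext x
    simp [QuadraticMap.polar_self]
  rw [h]
  fun_prop

/-- The differential of `Q` at `v` is the polar form of `v`. -/
theorem mem_tangentPlane_iff {d : ℕ} (Q : QuadraticForm ℝ (Fin d → ℝ)) (v w : Fin d → ℝ) :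
    w ∈ tangentPlane Q v ↔ QuadraticMap.polar Q v w = 0 := by
  rw [tangentPlane, LinearMap.mem_ker, ContinuousLinearMap.coe_coe,
    ← (Q.differentiable v).lineDeriv_eq_fderiv, QuadraticMap.lineDeriv]

/-- An isotropic vector of a semidefinite quadratic form lies in its radical. -/
theorem QuadraticMap.polar_eq_zero_of_nonneg {M : Type*} [AddCommGroup M] [Module ℝ M]
    {P : QuadraticForm ℝ M} (hP : ∀ x, 0 ≤ P x) {v : M} (hv : P v = 0) (w : M) :
    QuadraticMap.polar P v w = 0 := by
  have h : ∀ t : ℝ, 0 ≤ P w + t * QuadraticMap.polar P v w := fun t => by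
    have := hP (t • v + w)
    rw [QuadraticMap.map_add P, QuadraticMap.map_smul, hv, QuadraticMap.polar_smul_left] at this
    simpa using this
  by_contra hne
  have := h (-(P w + 1) / QuadraticMap.polar P v w)
  rw [div_mul_cancel₀ _ hne] at this
  linarith

/-- If `f i₀` spans the radical of a form `P` that is definite of rank `d - 1`, then `|P|`
dominates the squares of all the coordinates except the one along `f i₀`. -/
theorem IsDefiniteOfRank.exists_mul_sq_le_abs {d : ℕ} (hd : 1 ≤ d)
    {P : QuadraticForm ℝ (Fin d → ℝ)} (hP : IsDefiniteOfRank P (d - 1))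
    (f : Module.Basis (Fin d) ℝ (Fin d → ℝ)) (i₀ : Fin d) (hf : P (f i₀) = 0) :
    ∃ m : ℝ, 0 < m ∧ ∀ x i, i ≠ i₀ → m * f.repr x i ^ 2 ≤ |P x| := by
  wlog hpos : ∀ x, 0 ≤ P x generalizing P
  · have hneg : ∀ x, 0 ≤ (-P) x := fun x => by
      simpa using (hP.1.resolve_left hpos) x
    have hrank : quadRank (-P) = d - 1 := by
      have : (-P).polarBilin = -P.polarBilin := by
        ext x y
        simp [QuadraticMap.polar_neg]
      rw [quadRank, this, LinearMap.range_neg]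
      exact hP.2
    simpa using this ⟨Or.inl hneg, hrank⟩ (by simpa using hf) hneg
  have hker : Module.finrank ℝ (LinearMap.ker P.polarBilin) = 1 := by
    have h := LinearMap.finrank_range_add_finrank_ker P.polarBilin
    have h' : Module.finrank ℝ (LinearMap.range P.polarBilin) = d - 1 := hP.2
    rw [h', Module.finrank_fin_fun] at h
    omega
  have hmem : ∀ y, P y = 0 → y ∈ LinearMap.ker P.polarBilin := fun y hy =>
    LinearMap.mem_ker.2 (LinearMap.ext fun w => QuadraticMap.polar_eq_zero_of_nonneg hpos hy w)
  -- The radical is a line, so it is spanned by `f i₀`, and `P` is positive away from it.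
  have hrad : ∀ y, P y = 0 → f.repr y i₀ = 0 → y = 0 := fun y hy hy0 => by
    obtain ⟨a, ha⟩ := (finrank_eq_one_iff_of_nonzero' (⟨f i₀, hmem _ hf⟩ : LinearMap.ker P.polarBilin)
      (fun h => f.ne_zero i₀ (congrArg Subtype.val h))).1 hker ⟨y, hmem y hy⟩
    have ha' : a • f i₀ = y := congrArg Subtype.val ha
    rw [← ha'] at hy0 ⊢
    have : a = 0 := by simpa using hy0
    rw [this, zero_smul]
  let F : (Fin d → ℝ) → ℝ := fun c => P (f.equivFun.symm c)
  have hF : Continuous F := P.differentiable.continuous.comp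
    (LinearMap.continuous_of_finiteDimensional (f.equivFun.symm : (Fin d → ℝ) →ₗ[ℝ] (Fin d → ℝ)))
  have hcpt : IsCompact {c : Fin d → ℝ | c i₀ = 0 ∧ ‖c‖ = 1} := by
    refine (isCompact_sphere (0 : Fin d → ℝ) 1).of_isClosed_subset ?_ fun c hc => by
      simpa using hc.2
    exact (isClosed_eq (continuous_apply i₀) continuous_const).inter
      (isClosed_eq continuous_norm continuous_const)
  obtain ⟨m, hm, hmF⟩ := hcpt.exists_forall_le' hF.continuousOn (a := 0) fun c hc => by
    refine lt_of_le_of_ne (hpos _) fun h => ?_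
    have : f.equivFun.symm c = 0 := hrad _ h.symm (by
      rw [← Module.Basis.equivFun_apply, LinearEquiv.apply_symm_apply, hc.1])
    have hc0 : c = 0 := f.equivFun.symm.map_eq_zero_iff.1 this
    have := hc.2
    simp [hc0] at this
  refine ⟨m, hm, fun x i hi => ?_⟩
  rw [abs_of_nonneg (hpos x)]
  -- Removing the `f i₀`-component of `x` does not change `P x`.
  let c : Fin d → ℝ := Function.update (f.equivFun x) i₀ 0
  have hc : F c = P x := by
    have hcx : x = f.equivFun.symm c + f.equivFun x i₀ • f i₀ := by
      apply f.equivFun.injective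
      ext j
      rw [map_add, LinearEquiv.apply_symm_apply, map_smul, Pi.add_apply, Pi.smul_apply,
        f.equivFun_self]
      by_cases hj : j = i₀
      · subst hj; simp [c]
      · simp [c, hj, Ne.symm hj]
    conv_rhs => rw [hcx]
    rw [QuadraticMap.map_add P, QuadraticMap.map_smul, hf, QuadraticMap.polar_smul_right,
      QuadraticMap.polar_comm, QuadraticMap.polar_eq_zero_of_nonneg hpos hf]
    simp [F]
  have hci : f.repr x i = c i := by simp [c, hi]
  rw [← hc, hci]
  rcases eq_or_ne c 0 with h0 | h0
  · simp [h0, F]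
  have hn : 0 < ‖c‖ := norm_pos_iff.2 h0
  have h1 := hmF (‖c‖⁻¹ • c) ⟨by simp [c], by rw [norm_smul, norm_inv, norm_norm, inv_mul_cancel₀ hn.ne']⟩
  have h2 : F (‖c‖⁻¹ • c) = (‖c‖ ^ 2)⁻¹ * F c := by
    simp only [F]
    rw [map_smul, QuadraticMap.map_smul, smul_eq_mul, ← mul_inv, sq]
  rw [h2, le_inv_mul_iff₀ (by positivity)] at h1
  have h3 : c i ^ 2 ≤ ‖c‖ ^ 2 := by
    rw [← sq_abs]
    exact pow_le_pow_left₀ (abs_nonneg _) (norm_le_pi_norm c i) 2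
  nlinarith

/-- In an adapted basis `Q` is the hyperbolic product of the first two coordinates, up to a factor,
plus a form which does not involve the first coordinate. -/
theorem IsAdaptedBasis.apply_eq {d : ℕ} {hd : 3 ≤ d} {Q : QuadraticForm ℝ (Fin d → ℝ)}
    {v : Fin d → ℝ} {H : Submodule ℝ (Fin d → ℝ)} (hv : Q v = 0) (hH : tangentPlane Q v = H)
    {f : Module.Basis (Fin d) ℝ (Fin d → ℝ)} (hf : IsAdaptedBasis hd f v H) (x : Fin d → ℝ) :
    Q x = f.repr x ⟨0, by omega⟩ * f.repr x ⟨1, by omega⟩ *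
        QuadraticMap.polar Q (f ⟨0, by omega⟩) (f ⟨1, by omega⟩) +
      Q (f.equivFun.symm (Function.update (f.equivFun x) ⟨0, by omega⟩ 0)) := by
  set i₀ : Fin d := ⟨0, by omega⟩
  set i₁ : Fin d := ⟨1, by omega⟩
  obtain ⟨a, ha⟩ := Submodule.mem_span_singleton.1 hf.1
  have hQ0 : Q (f i₀) = 0 := by rw [← ha, QuadraticMap.map_smul, hv, smul_zero]
  set y := f.equivFun.symm (Function.update (f.equivFun x) i₀ 0) with hy
  have hyi : ∀ i, f.equivFun y i = Function.update (f.equivFun x) i₀ 0 i := fun i => by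
    rw [hy, LinearEquiv.apply_symm_apply]
  have hxy : x = f.equivFun x i₀ • f i₀ + y := by
    apply f.equivFun.injective
    ext j
    rw [map_add, map_smul, Pi.add_apply, Pi.smul_apply, f.equivFun_self, hyi]
    by_cases hj : j = i₀
    · subst hj; simp
    · simp [hj, Ne.symm hj]
  have hpolar : QuadraticMap.polar Q (f i₀) y =
      f.repr x i₁ * QuadraticMap.polar Q (f i₀) (f i₁) := by
    have h1 : Q.polarBilin (f i₀) y = ∑ i, f.equivFun y i * QuadraticMap.polar Q (f i₀) (f i) := by
      conv_lhs => rw [← f.sum_equivFun y, map_sum]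
      simp
    rw [QuadraticMap.polarBilin_apply_apply] at h1
    rw [h1, Finset.sum_eq_single i₁]
    · rw [hyi, Function.update_of_ne (by simp [i₀, i₁]), f.equivFun_apply]
    · intro i _ hi
      by_cases hi0 : i = i₀
      · rw [hyi, hi0, Function.update_self, zero_mul]
      · have : f i ∈ H := hf.2.2 i (by
          have h0 : i.val ≠ 0 := fun h => hi0 (Fin.ext h)
          have h1 : i.val ≠ 1 := fun h => hi (Fin.ext h)
          omega)
        rw [← hH, mem_tangentPlane_iff] at this
        rw [← ha, QuadraticMap.polar_smul_left, this, smul_zero, mul_zero]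
    · simp
  conv_lhs => rw [hxy]
  rw [QuadraticMap.map_add Q, QuadraticMap.map_smul, hQ0, QuadraticMap.polar_smul_left, hpolar,
    f.equivFun_apply, smul_zero, smul_eq_mul]
  ring

theorem IsAdaptedBasis.polar_ne_zero {d : ℕ} {hd : 3 ≤ d} {Q : QuadraticForm ℝ (Fin d → ℝ)}
    {v : Fin d → ℝ} {H : Submodule ℝ (Fin d → ℝ)} (hH : tangentPlane Q v = H)
    {f : Module.Basis (Fin d) ℝ (Fin d → ℝ)} (hf : IsAdaptedBasis hd f v H) :
    QuadraticMap.polar Q (f ⟨0, by omega⟩) (f ⟨1, by omega⟩) ≠ 0 := by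
  obtain ⟨a, ha⟩ := Submodule.mem_span_singleton.1 hf.1
  have ha0 : a ≠ 0 := by
    rintro rfl
    exact f.ne_zero _ (by rw [← ha, zero_smul])
  have h1 := hf.2.1
  rw [← hH, mem_tangentPlane_iff] at h1
  rw [← ha, QuadraticMap.polar_smul_left]
  exact mul_ne_zero ha0 h1

/-- The part of the forms `Q j` which does not involve the coordinate `i₀` is small if all the other
coordinates are: this is uniform in the coordinate `i₀`, which is replaced by `0`. -/
theorem exists_forall_abs_apply_update_lt {d t : ℕ} (Q : Fin t → QuadraticForm ℝ (Fin d → ℝ))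
    (f : Module.Basis (Fin d) ℝ (Fin d → ℝ)) (i₀ : Fin d) {ε : ℝ} (hε : 0 < ε) :
    ∃ δ : ℝ, 0 < δ ∧ ∀ x, (∀ i, i ≠ i₀ → |f.repr x i| < δ) →
      ∀ j, |Q j (f.equivFun.symm (Function.update (f.equivFun x) i₀ 0))| < ε := by
  have hF : Continuous fun c : Fin d → ℝ => fun j => Q j (f.equivFun.symm c) :=
    continuous_pi fun j => (Q j).differentiable.continuous.comp
      (LinearMap.continuous_of_finiteDimensional (f.equivFun.symm : (Fin d → ℝ) →ₗ[ℝ] (Fin d → ℝ)))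
  obtain ⟨δ, hδ, h⟩ := Metric.continuous_iff.1 hF 0 ε hε
  refine ⟨δ, hδ, fun x hx j => ?_⟩
  have := h (Function.update (f.equivFun x) i₀ 0) (by
    rw [dist_zero_right, pi_norm_lt_iff hδ]
    intro i
    by_cases hi : i = i₀
    · subst hi; simpa using hδ
    · simpa [hi] using hx i hi)
  rw [dist_pi_lt_iff hε] at this
  simpa using this j

/-- If the product of the first two coordinates and all the coordinates but the first are small,
then so are all the values `Q j x`. -/
theorem IsAdaptedBasis.exists_forall_abs_lt {d t : ℕ} {hd : 3 ≤ d}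
    {Q : Fin t → QuadraticForm ℝ (Fin d → ℝ)} {v : Fin d → ℝ} {H : Submodule ℝ (Fin d → ℝ)}
    (hH : HasCommonTangentPlane Q v H) {f : Module.Basis (Fin d) ℝ (Fin d → ℝ)}
    (hf : IsAdaptedBasis hd f v H) {ε : ℝ} (hε : 0 < ε) :
    ∃ δ : ℝ, 0 < δ ∧ ∀ x, |f.repr x ⟨0, by omega⟩ * f.repr x ⟨1, by omega⟩| < δ →
      (∀ i, i ≠ ⟨0, by omega⟩ → |f.repr x i| < δ) → ∀ j, |Q j x| < ε := by
  obtain ⟨δ, hδ, h⟩ := exists_forall_abs_apply_update_lt Q f ⟨0, by omega⟩ (half_pos hε)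
  let β : Fin t → ℝ := fun j => QuadraticMap.polar (Q j) (f ⟨0, by omega⟩) (f ⟨1, by omega⟩)
  have hβ : 0 < ‖β‖ + 1 := by positivity
  refine ⟨min δ (ε / 2 / (‖β‖ + 1)), by positivity, fun x hx0 hx j => ?_⟩
  have h1 := h x (fun i hi => (hx i hi).trans_le (min_le_left _ _)) j
  have h2 := hx0.trans_le (min_le_right _ _)
  rw [lt_div_iff₀ hβ] at h2
  have h3 : |β j| ≤ ‖β‖ + 1 := (norm_le_pi_norm β j).trans (by linarith)
  rw [hf.apply_eq (hH.2 j).1 (hH.2 j).2 x]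
  refine (abs_add_le _ _).trans_lt ?_
  rw [abs_mul]
  have := mul_le_mul_of_nonneg_left h3 (abs_nonneg (f.repr x ⟨0, by omega⟩ * f.repr x ⟨1, by omega⟩))
  simp only [β] at this
  linarith

/-- If a combination of the forms is definite of rank `d - 1`, then conversely small values of all
the `Q j x` force the product of the first two coordinates and all the coordinates but the first
to be small. -/
theorem IsAdaptedBasis.exists_forall_repr_lt {d t : ℕ} {hd : 3 ≤ d} (ht : 1 ≤ t)
    {Q : Fin t → QuadraticForm ℝ (Fin d → ℝ)} {v : Fin d → ℝ} {H : Submodule ℝ (Fin d → ℝ)}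
    (hH : HasCommonTangentPlane Q v H) {f : Module.Basis (Fin d) ℝ (Fin d → ℝ)}
    (hf : IsAdaptedBasis hd f v H) {α : Fin t → ℝ}
    (hα : IsDefiniteOfRank (∑ j, α j • Q j) (d - 1)) {δ : ℝ} (hδ : 0 < δ) :
    ∃ ε : ℝ, 0 < ε ∧ ∀ x, (∀ j, |Q j x| < ε) →
      |f.repr x ⟨0, by omega⟩ * f.repr x ⟨1, by omega⟩| < δ ∧
      ∀ i, i ≠ ⟨0, by omega⟩ → |f.repr x i| < δ := by
  have hPx : ∀ x, (∑ j, α j • Q j) x = ∑ j, α j * Q j x := fun x => by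
    simp
  obtain ⟨m, hm, hP⟩ := hα.exists_mul_sq_le_abs (by omega) f ⟨0, by omega⟩ (by
    obtain ⟨a, ha⟩ := Submodule.mem_span_singleton.1 hf.1
    rw [hPx, ← ha]
    exact Finset.sum_eq_zero fun j _ => by simp [QuadraticMap.map_smul, (hH.2 j).1])
  let j₀ : Fin t := ⟨0, ht⟩
  have hβ := abs_pos.2 (hf.polar_ne_zero (hH.2 j₀).2)
  set β := QuadraticMap.polar (Q j₀) (f ⟨0, by omega⟩) (f ⟨1, by omega⟩)
  obtain ⟨δ₁, hδ₁, h⟩ := exists_forall_abs_apply_update_lt Q f ⟨0, by omega⟩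
    (show 0 < |β| * δ / 2 by positivity)
  let A := ∑ j, |α j| + 1
  have hA : 0 < A := by positivity
  have hδ' : 0 < min δ δ₁ := lt_min hδ hδ₁
  refine ⟨min (|β| * δ / 2) (m * min δ δ₁ ^ 2 / A), by positivity, fun x hx => ?_⟩
  have hxi : ∀ i, i ≠ ⟨0, by omega⟩ → |f.repr x i| < min δ δ₁ := fun i hi => by
    have h1 : |(∑ j, α j • Q j) x| ≤ ∑ j, |α j| * (m * min δ δ₁ ^ 2 / A) := by
      rw [hPx]
      refine (Finset.abs_sum_le_sum_abs _ _).trans (Finset.sum_le_sum fun j _ => ?_)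
      rw [abs_mul]
      exact mul_le_mul_of_nonneg_left ((hx j).le.trans (min_le_right _ _)) (abs_nonneg _)
    have h2 : ∑ j, |α j| * (m * min δ δ₁ ^ 2 / A) < m * min δ δ₁ ^ 2 := by
      rw [← Finset.sum_mul, mul_div_assoc', div_lt_iff₀ hA, mul_comm]
      exact mul_lt_mul_of_pos_left (lt_add_one _) (by positivity)
    have h3 := ((hP x i hi).trans h1).trans_lt h2
    exact abs_lt_of_sq_lt_sq (lt_of_mul_lt_mul_left h3 hm.le) hδ'.le
  refine ⟨?_, fun i hi => (hxi i hi).trans_le (min_le_left _ _)⟩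
  have h1 := h x (fun i hi => (hxi i hi).trans_le (min_le_right _ _)) j₀
  have h2 := (hx j₀).trans_le (min_le_left _ _)
  have h3 := hf.apply_eq (hH.2 j₀).1 (hH.2 j₀).2 x
  have h4 := (abs_sub (Q j₀ x) (Q j₀ (f.equivFun.symm (Function.update (f.equivFun x)
    ⟨0, by omega⟩ 0)))).trans_lt (add_lt_add h2 h1)
  rw [h3, add_sub_cancel_right, abs_mul] at h4
  refine lt_of_mul_lt_mul_left ?_ hβ.le
  linarith

/-! ### The diagonal flow -/

theorem repr_diagFlow_mulVec {d : ℕ} (hd : 3 ≤ d) (f : Module.Basis (Fin d) ℝ (Fin d → ℝ))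
    (s : ℝ) (x : Fin d → ℝ) (i : Fin d) :
    f.repr ((diagFlow hd f s).1.mulVec x) i = flowWeight s i * f.repr x i := by
  conv_lhs => rw [← f.sum_repr x]
  simp_rw [Matrix.mulVec_sum, Matrix.mulVec_smul, diagFlow_mulVec]
  simp [Finsupp.single_apply, mul_comm]

/-- The semiorbit is relatively compact if and only if the lattices `a_s ℤᵈ`, `s > 0`, have no
arbitrarily short nonzero vectors. -/
theorem isRelativelyCompact_semiorbit_iff {d : ℕ} (hd : 3 ≤ d)
    (f : Module.Basis (Fin d) ℝ (Fin d → ℝ)) :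
    IsRelativelyCompact (semiorbit hd f) ↔ ∃ ε : ℝ, 0 < ε ∧ ∀ s : ℝ, 0 < s →
      ∀ x : Fin d → ℤ, x ≠ 0 →
        ∃ i, ε ≤ |(diagFlow hd f s).1.mulVec (fun i => (x i : ℝ)) i| := by
  have h : semiorbit hd f = (QuotientGroup.mk : SL(d, ℝ) → SL(d, ℝ) ⧸ integerSL d) ''
      (diagFlow hd f '' Set.Ioi 0) := by
    ext q
    simp [semiorbit, eq_comm]
  rw [h, isRelativelyCompact_image_mk_iff]
  simp

theorem theorem2 {d t : ℕ} (hd : 3 ≤ d) (ht : 1 ≤ t)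
    (Q : Fin t → QuadraticForm ℝ (Fin d → ℝ))
    (hnondeg : ∀ j, (Q j).polarBilin.Nondegenerate) (hindef : ∀ j, IsIndefinite (Q j))
    (v : Fin d → ℝ) (H : Submodule ℝ (Fin d → ℝ)) (hH : HasCommonTangentPlane Q v H)
    (f : Module.Basis (Fin d) ℝ (Fin d → ℝ)) (hf : IsAdaptedBasis hd f v H) :
    (¬ IsRelativelyCompact (semiorbit hd f) → HasSmallIntegerValues Q) ∧
      ((∃ α : Fin t → ℝ, IsDefiniteOfRank (∑ j, α j • Q j) (d - 1)) →
        HasSmallIntegerValues Q → ¬ IsRelativelyCompact (semiorbit hd f)) := by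
  rw [isRelativelyCompact_semiorbit_iff]
  constructor
  · intro h ε hε
    push Not at h
    obtain ⟨δ, hδ, hQ⟩ := hf.exists_forall_abs_lt hH hε
    let K := ‖(f.equivFunL : (Fin d → ℝ) →L[ℝ] (Fin d → ℝ))‖ + 1
    have hK : 0 < K := by positivity
    obtain ⟨s, hs, x, hx0, hx⟩ := h (min δ 1 / K) (by positivity)
    have hsmall : ∀ i, flowWeight s i * |f.repr (fun i => (x i : ℝ)) i| < min δ 1 := fun i => by
      set y := (diagFlow hd f s).1.mulVec (fun i => (x i : ℝ)) with hy
      have hw : 0 < flowWeight s i := by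
        unfold flowWeight; split_ifs <;> positivity
      have h1 : ‖y‖ < min δ 1 / K := (pi_norm_lt_iff (by positivity)).2 hx
      rw [← abs_of_pos hw, ← abs_mul, ← repr_diagFlow_mulVec hd, ← hy]
      calc |f.repr y i| ≤ ‖f.equivFunL y‖ := norm_le_pi_norm (f.equivFunL y) i
        _ ≤ ‖(f.equivFunL : (Fin d → ℝ) →L[ℝ] (Fin d → ℝ))‖ * ‖y‖ :=
          (f.equivFunL : (Fin d → ℝ) →L[ℝ] (Fin d → ℝ)).le_opNorm y
        _ ≤ K * ‖y‖ := by
          gcongr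
          exact (lt_add_one _).le
        _ < min δ 1 := by rwa [lt_div_iff₀ hK, mul_comm] at h1
    refine ⟨x, hx0, hQ _ ?_ fun i hi => ?_⟩
    · -- The flow preserves the product of the first two coordinates.
      have h0 := hsmall ⟨0, by omega⟩
      have h1 := hsmall ⟨1, by omega⟩
      set a := f.repr (fun i => (x i : ℝ)) ⟨0, by omega⟩
      set b := f.repr (fun i => (x i : ℝ)) ⟨1, by omega⟩
      simp only [flowWeight, one_ne_zero, if_true, if_false] at h0 h1
      have hab : |a * b| = (Real.exp (-s) * |a|) * (Real.exp s * |b|) := by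
        rw [mul_mul_mul_comm, ← Real.exp_add, neg_add_cancel, Real.exp_zero, one_mul, abs_mul]
      rw [hab]
      calc _ ≤ (Real.exp (-s) * |a|) * 1 := by
            gcongr
            exact h1.le.trans (min_le_right _ _)
        _ < δ := by
          rw [mul_one]
          exact h0.trans_le (min_le_left _ _)
    · have hw : 1 ≤ flowWeight s i := by
        have : i.val ≠ 0 := fun h => hi (Fin.ext h)
        simp only [flowWeight, this, if_false]
        split_ifs
        · exact Real.one_le_exp hs.le
        · exact le_rfl
      exact (le_mul_of_one_le_left (abs_nonneg _) hw).trans_lt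
        ((hsmall i).trans_le (min_le_left _ _))
  · rintro ⟨α, hα⟩ hQ ⟨ε, hε, h⟩
    let K := ‖(f.equivFunL.symm : (Fin d → ℝ) →L[ℝ] (Fin d → ℝ))‖ + 1
    have hK : 0 < K := by positivity
    have hnorm : ∀ y, ‖y‖ ≤ K * ‖f.equivFun y‖ := fun y => by
      calc ‖y‖ = ‖f.equivFunL.symm (f.equivFunL y)‖ := by simp
        _ ≤ ‖(f.equivFunL.symm : (Fin d → ℝ) →L[ℝ] (Fin d → ℝ))‖ * ‖f.equivFunL y‖ :=
          (f.equivFunL.symm : (Fin d → ℝ) →L[ℝ] (Fin d → ℝ)).le_opNorm _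
        _ ≤ K * ‖f.equivFun y‖ := by
          refine mul_le_mul (lt_add_one _).le le_rfl (norm_nonneg _) hK.le
    -- Vectors with coordinates at most `ρ` are shorter than `ε` and than any nonzero integer vector.
    let ρ := min ε 1 / (2 * K)
    have hρ : 0 < ρ := by positivity
    have hKρ : K * ρ = min ε 1 / 2 := by simp only [ρ]; field_simp
    have hmin : 0 < min ε 1 := lt_min hε one_pos
    have hρε : K * ρ < ε := by linarith [min_le_left ε 1]
    have hρ1 : K * ρ < 1 := by linarith [min_le_right ε 1]
    obtain ⟨ε', hε', hB⟩ := hf.exists_forall_repr_lt ht hH hα (δ := min ρ (ρ ^ 2)) (by positivity)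
    obtain ⟨x, hx0, hx⟩ := hQ ε' hε'
    obtain ⟨hprod, hrest⟩ := hB _ hx
    set z : Fin d → ℝ := fun i => (x i : ℝ) with hz
    set i₀ : Fin d := ⟨0, by omega⟩
    set i₁ : Fin d := ⟨1, by omega⟩
    have hrest' : ∀ i, i ≠ i₀ → |f.repr z i| ≤ ρ := fun i hi =>
      (hrest i hi).le.trans (min_le_left _ _)
    have hc0 : ρ < |f.repr z i₀| := by
      by_contra! hle
      obtain ⟨i, hi⟩ : ∃ i, x i ≠ 0 := by
        by_contra! h
        exact hx0 (funext h)
      have h1 : (1 : ℝ) ≤ ‖z‖ := le_trans (by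
        rw [Real.norm_eq_abs]
        change (1 : ℝ) ≤ |(x i : ℝ)|
        exact_mod_cast Int.one_le_abs hi) (norm_le_pi_norm z i)
      have h2 : ‖f.equivFun z‖ ≤ ρ := (pi_norm_le_iff_of_nonneg hρ.le).2 fun i => by
        by_cases hi : i = i₀
        · subst hi; exact hle
        · exact hrest' i hi
      have := (hnorm z).trans (mul_le_mul_of_nonneg_left h2 hK.le)
      linarith
    -- At this time the flow has contracted the first coordinate to size exactly `ρ`.
    let s := Real.log (|f.repr z i₀| / ρ)
    have hs : 0 < s := Real.log_pos ((one_lt_div hρ).2 hc0)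
    have hc0' : 0 < |f.repr z i₀| := hρ.trans hc0
    have hexp : Real.exp s = |f.repr z i₀| / ρ := Real.exp_log (by positivity)
    have hsmall : ‖f.equivFun ((diagFlow hd f s).1.mulVec z)‖ ≤ ρ := by
      refine (pi_norm_le_iff_of_nonneg hρ.le).2 fun i => ?_
      rw [f.equivFun_apply, repr_diagFlow_mulVec, Real.norm_eq_abs, abs_mul]
      by_cases hi : i = i₀
      · rw [hi]
        simp only [flowWeight, i₀, if_true]
        rw [Real.abs_exp, Real.exp_neg, hexp, inv_div, div_mul_cancel₀ _ hc0'.ne']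
      by_cases hi1 : i = i₁
      · rw [hi1]
        simp only [flowWeight, i₁, one_ne_zero, if_true, if_false]
        rw [Real.abs_exp, hexp, div_mul_eq_mul_div, ← abs_mul, div_le_iff₀ hρ, ← sq]
        exact hprod.le.trans (min_le_right _ _)
      · have h0 : i.val ≠ 0 := fun h => hi (Fin.ext h)
        have h1 : i.val ≠ 1 := fun h => hi1 (Fin.ext h)
        simpa [flowWeight, h0, h1] using hrest' i hi
    obtain ⟨i, hi⟩ := h s hs x hx0
    have h1 := norm_le_pi_norm ((diagFlow hd f s).1.mulVec z) i
    have h2 := (hnorm ((diagFlow hd f s).1.mulVec z)).trans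
      (mul_le_mul_of_nonneg_left hsmall hK.le)
    rw [Real.norm_eq_abs] at h1
    linarith
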